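/- Let $\mathbb{T}=\{z\in\mathbb{C}:|z|=1\}$ and let $\sigma\colon \mathbb{T}^2\to\mathbb{T}^2$ be a topological group automorphism of infinite order (for example, a hyperbolic toral automorphism). Let $G=\mathbb{T}^2\rtimes_\sigma\mathbb{Z}$ be the corresponding two-dimensional Lie group, where $n\in\mathbb{Z}$ (discrete) acts on $\mathbb{T}^2$ by $\sigma^n$ and $G$ carries the product topology. Then the conjugation action $G\times G\to G$, $(g,x)\mapsto gxg^{-1}$, is not Rosenthal representable. That is, there do not exist a real Banach space $V$ containing no isomorphic copy of $\ell^1$, a homomorphism $h$ from $G$ to the group of surjective linear isometries of $V$ that is continuous for the strong operator topology, and a norm-bounded map $\alpha\colon G\to V^*$ that is a topological embedding for the weak-star topology on $V^*$ and satisfies $\alpha(gxg^{-1})(v)=\alpha(x)(h(g)^{-1}v)$ for all $g,x\in G$ and $v\in V$. -/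

import Mathlib

open Topology

universe w u v

namespace BanachRep

/-- The strong operator topology on the group of (surjective) linear isometries of a real normed
space: the topology of pointwise convergence. -/
@[reducible] def strongOperatorTopology (V : Type w) [NormedAddCommGroup V] [NormedSpace ℝ V] :
    TopologicalSpace (V ≃ₗᵢ[ℝ] V) :=
  TopologicalSpace.induced (fun (T : V ≃ₗᵢ[ℝ] V) (x : V) => T x) inferInstance

/-- The dual action of a linear isometry `T` on functionals: `(T φ) x = φ (T⁻¹ x)`. -/
noncomputable def dualAct {V : Type w} [NormedAddCommGroup V] [NormedSpace ℝ V]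
    (T : V ≃ₗᵢ[ℝ] V) (φ : WeakDual ℝ V) : WeakDual ℝ V :=
  StrongDual.toWeakDual
    ((WeakDual.toStrongDual φ).comp (T⁻¹ : V ≃ₗᵢ[ℝ] V).toContinuousLinearEquiv.toContinuousLinearMap)

theorem dualAct_apply {V : Type w} [NormedAddCommGroup V] [NormedSpace ℝ V]
    (T : V ≃ₗᵢ[ℝ] V) (φ : WeakDual ℝ V) (x : V) : dualAct T φ x = φ (T⁻¹ x) := rfl

/-- A proper representation of the `G`-space `X` on `V`: a continuous homomorphism `h` from `G`
to the linear isometries of `V` (strong operator topology), and a norm-bounded equivariant map `α`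
from `X` to the dual of `V` which is a topological embedding for the weak-star topology. -/
structure ProperRepresentation (G : Type u) [Group G] [TopologicalSpace G]
    (X : Type v) [TopologicalSpace X] [MulAction G X]
    (V : Type w) [NormedAddCommGroup V] [NormedSpace ℝ V] where
  h : G →* (V ≃ₗᵢ[ℝ] V)
  continuous_h : Continuous[_, strongOperatorTopology V] h
  α : X → WeakDual ℝ V
  isEmbedding_α : IsEmbedding α
  bounded_α : ∃ C : ℝ, ∀ x, ‖WeakDual.toStrongDual (α x)‖ ≤ C
  equivariant : ∀ (g : G) (x : X), α (g • x) = dualAct (h g) (α x)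

/-- `V` contains an isomorphic copy of the Banach space `ℓ¹`. -/
def ContainsL1 (V : Type w) [NormedAddCommGroup V] [NormedSpace ℝ V] : Prop :=
  ∃ T : lp (fun _ : ℕ => ℝ) 1 →L[ℝ] V, ∃ c : ℝ, 0 < c ∧ ∀ a, c * ‖a‖ ≤ ‖T a‖

/-- The `G`-space `X` is Rosenthal representable: it has a proper representation on some real
Banach space that contains no isomorphic copy of `ℓ¹`. -/
def RosenthalRepresentable (G : Type u) [Group G] [TopologicalSpace G] [IsTopologicalGroup G]
    (X : Type v) [TopologicalSpace X] [MulAction G X] [ContinuousSMul G X] : Prop :=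
  ∃ (V : Type w) (_ : NormedAddCommGroup V) (_ : NormedSpace ℝ V) (_ : CompleteSpace V),
    ¬ ContainsL1 V ∧ Nonempty (ProperRepresentation G X V)

/-- The space `G` on which the group `G` acts by conjugation. -/
def ConjSpace (G : Type u) : Type u := G

instance (G : Type u) [TopologicalSpace G] : TopologicalSpace (ConjSpace G) :=
  inferInstanceAs (TopologicalSpace G)

instance (G : Type u) [Group G] : MulAction G (ConjSpace G) where
  smul g x := (g * (show G from x) * g⁻¹ : G)
  one_smul := show ∀ x : G, (1 * x * 1⁻¹ : G) = x by simp
  mul_smul := show ∀ a b x : G, a * b * x * (a * b)⁻¹ = a * (b * x * b⁻¹) * a⁻¹ by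
    simp [mul_assoc]

instance (G : Type u) [Group G] [TopologicalSpace G] [IsTopologicalGroup G] :
    ContinuousSMul G (ConjSpace G) where
  continuous_smul := show Continuous fun p : G × G => p.1 * p.2 * p.1⁻¹ by fun_prop

/-- The two-dimensional torus, as a topological group. -/
abbrev Torus : Type := Circle × Circle

/-- The semidirect product `𝕋² ⋊ ℤ`, where `n : ℤ` acts on the torus by `σ ^ n`. -/
abbrev TorusSemidirect (σ : Torus ≃ₜ* Torus) : Type :=
  Torus ⋊[zpowersHom (MulAut Torus) σ.toMulEquiv] Multiplicative ℤ

/-- The product topology of `𝕋² × ℤ` (with `ℤ` discrete). -/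
noncomputable instance (σ : Torus ≃ₜ* Torus) : TopologicalSpace (TorusSemidirect σ) :=
  TopologicalSpace.induced (fun g => (g.left, g.right)) inferInstance

theorem continuous_zpow (σ : Torus ≃ₜ* Torus) (n : ℤ) :
    Continuous (σ.toMulEquiv ^ n : MulAut Torus) := by
  have hnat : ∀ (τ : MulAut Torus), Continuous τ → ∀ k : ℕ, Continuous (τ ^ k : MulAut Torus) := by
    intro τ hτ k
    induction k with
    | zero => exact continuous_id
    | succ k ih => rw [pow_succ]; exact ih.comp hτ
  rcases n with k | k
  · exact hnat _ σ.continuous_toFun k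
  · rw [zpow_negSucc, ← inv_pow]
    exact hnat _ σ.continuous_invFun _

theorem continuous_action (σ : Torus ≃ₜ* Torus) :
    Continuous fun p : Multiplicative ℤ × Torus =>
      zpowersHom (MulAut Torus) σ.toMulEquiv p.1 p.2 :=
  continuous_prod_of_discrete_left.mpr fun n => continuous_zpow σ n.toAdd

instance (σ : Torus ≃ₜ* Torus) : IsTopologicalGroup (TorusSemidirect σ) := by
  have hind : IsInducing fun g : TorusSemidirect σ => (g.left, g.right) := ⟨rfl⟩
  have hl : Continuous fun g : TorusSemidirect σ => g.left := continuous_fst.comp hind.continuous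
  have hr : Continuous fun g : TorusSemidirect σ => g.right := continuous_snd.comp hind.continuous
  refine { continuous_mul := ?_, continuous_inv := ?_ }
  · refine hind.continuous_iff.mpr (Continuous.prodMk ?_ ?_)
    · exact (hl.comp continuous_fst).mul ((continuous_action σ).comp
        ((hr.comp continuous_fst).prodMk (hl.comp continuous_snd)))
    · exact (hr.comp continuous_fst).mul (hr.comp continuous_snd)
  · refine hind.continuous_iff.mpr (Continuous.prodMk ?_ ?_)
    · exact (continuous_action σ).comp (hr.inv.prodMk hl.inv)
    · exact hr.inv

end BanachRep

/-! Restrict a putative representation to the normal torus with Haar measure. Each `v` gives a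
continuous function `f v` on the torus, and equivariance makes `f v ∘ σ ^ n` the function attached
to a vector of norm `‖v‖`. A bounded sequence in a space without `ℓ¹` must give functions that are
`L²`-Cauchy along every ultrafilter (`tendsto_integral_sq_sub_of_not_containsL1`). Otherwise some
differences tend weakly to zero while their `L²`-norms stay away from zero. A subsequence is then
nearly orthogonal to the Riesz products of its earlier terms, and testing against these densities
gives a lower `ℓ¹`-estimate, first in supremum norm, then in `V`. Continuous functions with
`L²`-Cauchy orbit form an algebra; it separates points since `α` is injective, so by
Stone–Weierstrass and a uniform estimate it contains every continuous function. But as `σ` has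
infinite order, some coordinate character has infinitely many distinct translates, and distinct
characters are at `L²`-distance `√2`: a contradiction. -/

open MeasureTheory Filter Topology

/-! ### Weak limits along ultrafilters -/

/-- A bounded family in a Hilbert space converges weakly along every ultrafilter. -/
theorem exists_weak_limit {ι H : Type*} [NormedAddCommGroup H] [InnerProductSpace ℝ H]
    [CompleteSpace H] (W : Ultrafilter ι) (x : ι → H) (C : ℝ) (hx : ∀ i, ‖x i‖ ≤ C) :
    ∃ g : H, ∀ y, Tendsto (fun i => inner ℝ (x i) y) W (𝓝 (inner ℝ g y)) := by
  -- Banach–Alaoglu, transported through the Riesz identification of `H` with its dual.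
  let F : ι → WeakDual ℝ H := fun i => StrongDual.toWeakDual (InnerProductSpace.toDual ℝ H (x i))
  obtain ⟨L, -, hL⟩ := (WeakDual.isCompact_closedBall (𝕜 := ℝ) (E := H) 0 C).ultrafilter_le_nhds
    (W.map F) (by
      rw [le_principal_iff, Ultrafilter.coe_map, mem_map]
      refine Filter.univ_mem' fun i => ?_
      simp only [Set.mem_preimage, mem_closedBall_zero_iff]
      exact ((InnerProductSpace.toDual ℝ H).norm_map (x i)).trans_le (hx i))
  refine ⟨(InnerProductSpace.toDual ℝ H).symm (WeakDual.toStrongDual L), fun y => ?_⟩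
  have h1 : Tendsto F W (𝓝 L) := hL
  have h2 := ((WeakDual.eval_continuous y).tendsto L).comp h1
  rw [InnerProductSpace.toDual_symm_apply]
  exact h2

/-- A family bounded in `L²` converges weakly along every ultrafilter. -/
theorem exists_weak_limit_memLp {ι X : Type*} [MeasurableSpace X] (μ : Measure X)
    [IsProbabilityMeasure μ] (W : Ultrafilter ι) (f : ι → X → ℝ) (hf : ∀ i, Measurable (f i))
    (C : ℝ) (hC : ∀ i x, |f i x| ≤ C) :
    ∃ g : X → ℝ, MemLp g 2 μ ∧ ∀ φ : X → ℝ, MemLp φ 2 μ →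
      Tendsto (fun i => ∫ x, φ x * f i x ∂μ) W (𝓝 (∫ x, φ x * g x ∂μ)) := by
  have hm : ∀ i, MemLp (f i) 2 μ := fun i =>
    MemLp.of_bound (hf i).aestronglyMeasurable C (Eventually.of_forall (hC i))
  have hinner : ∀ (a b : X → ℝ) (ha : MemLp a 2 μ) (hb : MemLp b 2 μ),
      inner ℝ (ha.toLp a) (hb.toLp b) = ∫ x, b x * a x ∂μ := by
    intro a b ha hb
    rw [L2.inner_def]
    refine integral_congr_ae ?_
    filter_upwards [ha.coeFn_toLp, hb.coeFn_toLp] with x h1 h2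
    rw [h1, h2]; rfl
  obtain ⟨g, hg⟩ := exists_weak_limit W (fun i => (hm i).toLp (f i)) C fun i => by
    have := Lp.norm_le_of_ae_bound (p := 2) (μ := μ) (f := (hm i).toLp (f i)) (C := C)
      (by
        have hne : Nonempty X := nonempty_of_isProbabilityMeasure μ
        exact (abs_nonneg _).trans (hC i hne.some))
      (by filter_upwards [(hm i).coeFn_toLp] with x h1; rw [h1]; exact hC i x)
    simpa [measureUnivNNReal] using this
  refine ⟨g, Lp.memLp g, fun φ hφ => ?_⟩
  have := hg (hφ.toLp φ)
  simp only [hinner] at this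
  have e : inner ℝ g (hφ.toLp φ) = ∫ x, φ x * g x ∂μ := by
    rw [← hinner g φ (Lp.memLp g) hφ, Lp.toLp_coeFn]
  rwa [e] at this

/-! ### Riesz products and `ℓ¹`-sequences in supremum norm -/

/-- Recursive choice of a sequence each of whose terms may depend on all earlier ones. -/
theorem exists_seq_of_forall_fin {ι : Type*} (R : ∀ k : ℕ, (Fin k → ι) → ι → Prop)
    (h : ∀ k p, ∃ a, R k p a) : ∃ i : ℕ → ι, ∀ k, R k (fun j => i j) (i k) := by
  choose c hc using h
  let i : ℕ → ι := WellFounded.fix Nat.lt_wfRel.wf fun k ih => c k fun j => ih j j.2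
  refine ⟨i, fun k => ?_⟩
  have : i k = c k fun j => i j := WellFounded.fix_eq _ _ _
  rw [this]
  exact hc _ _

/-- The sign `±1` coded by a Boolean. -/
def boolSign (b : Bool) : ℝ := if b then 1 else -1

theorem abs_boolSign (b : Bool) : |boolSign b| = 1 := by cases b <;> simp [boolSign]

/-- The Riesz product `∏ (1 ± d_{i j})`. -/
noncomputable def rieszProd {ι X : Type*} (d : ι → X → ℝ) (i : ℕ → ι) (s : ℕ → Bool) (k : ℕ)
    (x : X) : ℝ :=
  ∏ j ∈ Finset.range k, (1 + boolSign (s j) * d (i j) x)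

theorem one_add_boolSign_mul_mem {ι X : Type*} {d : ι → X → ℝ} (hb : ∀ i x, |d i x| ≤ 1) (b : Bool) (i : ι) (x : X) :
    0 ≤ 1 + boolSign b * d i x ∧ 1 + boolSign b * d i x ≤ 2 := by
  have : |boolSign b * d i x| ≤ 1 := by rw [abs_mul, abs_boolSign, one_mul]; exact hb i x
  rw [abs_le] at this
  constructor <;> linarith

/-- Nonnegativity makes a Riesz product a density, so a pointwise upper bound survives integration
against it. -/
theorem rieszProd_nonneg {ι X : Type*} {d : ι → X → ℝ} (hb : ∀ i x, |d i x| ≤ 1) (i : ℕ → ι) (s : ℕ → Bool) (k : ℕ) (x : X) :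
    0 ≤ rieszProd d i s k x :=
  Finset.prod_nonneg fun j _ => (one_add_boolSign_mul_mem hb (s j) (i j) x).1

section Riesz

variable {ι X : Type*} [MeasurableSpace X] {μ : Measure X} [IsProbabilityMeasure μ]
  {d : ι → X → ℝ}

theorem memLp_top_prod_one_add {κ : Type*} (hm : ∀ i, Measurable (d i))
    (hb : ∀ i x, |d i x| ≤ 1) (t : Finset κ) (p : κ → ι) (s : κ → Bool) :
    MemLp (fun x => ∏ j ∈ t, (1 + boolSign (s j) * d (p j) x)) ⊤ μ := by
  refine MemLp.of_bound (Measurable.aestronglyMeasurable ?_) (2 ^ t.card)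
    (Eventually.of_forall fun x => ?_)
  · exact Finset.measurable_fun_prod _ fun j _ => ((hm (p j)).const_mul _).const_add _
  · rw [Real.norm_of_nonneg (Finset.prod_nonneg fun j _ =>
      (one_add_boolSign_mul_mem hb (s j) (p j) x).1)]
    refine (Finset.prod_le_prod (fun j _ => (one_add_boolSign_mul_mem hb (s j) (p j) x).1)
      fun j _ => (one_add_boolSign_mul_mem hb (s j) (p j) x).2).trans_eq ?_
    simp

theorem memLp_top_rieszProd (hm : ∀ i, Measurable (d i)) (hb : ∀ i x, |d i x| ≤ 1) (i : ℕ → ι)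
    (s : ℕ → Bool) (k : ℕ) : MemLp (rieszProd d i s k) ⊤ μ :=
  memLp_top_prod_one_add hm hb (Finset.range k) i s

theorem memLp_top_of_abs_le_one (hm : ∀ i, Measurable (d i)) (hb : ∀ i x, |d i x| ≤ 1) (i : ι) :
    MemLp (d i) ⊤ μ :=
  MemLp.of_bound (hm i).aestronglyMeasurable 1 (Eventually.of_forall (hb i))

/-- One can choose a sequence each of whose terms is almost orthogonal to the Riesz products of the
earlier ones. -/
theorem exists_seq_almost_orthogonal (hm : ∀ i, Measurable (d i)) (hb : ∀ i x, |d i x| ≤ 1)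
    (W : Filter ι) [W.NeBot]
    (h0 : ∀ φ, MemLp φ 2 μ → Tendsto (fun i => ∫ x, φ x * d i x ∂μ) W (𝓝 0))
    {q : X → ℝ} (hq : MemLp q 2 μ) (hdq : ∀ φ, MemLp φ 2 μ →
      Tendsto (fun i => ∫ x, φ x * d i x ^ 2 ∂μ) W (𝓝 (∫ x, φ x * q x ∂μ)))
    (ε : ℕ → ℝ) (hε : ∀ k, 0 < ε k) :
    ∃ i : ℕ → ι, ∀ (s : ℕ → Bool) (k : ℕ),
      |∫ x, rieszProd d i s k x * d (i k) x ∂μ| ≤ ε k ∧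
      |∫ x, rieszProd d i s k x * q x * d (i k) x ∂μ| ≤ ε k ∧
      |∫ x, rieszProd d i s k x * d (i k) x ^ 2 ∂μ - ∫ x, rieszProd d i s k x * q x ∂μ| ≤ ε k ∧
      ∀ j < k, |∫ x, rieszProd d i s k x * d (i j) x * d (i k) x ∂μ| ≤ ε k := by
  -- Signs are indexed by `Fin k`: there are only finitely many patterns, so one index can serve
  -- them all, and the chosen sequence does not depend on `s`.
  let P : ∀ k : ℕ, (Fin k → ι) → (Fin k → Bool) → X → ℝ := fun k p s x =>
    ∏ j : Fin k, (1 + boolSign (s j) * d (p j) x)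
  obtain ⟨i, hi⟩ := exists_seq_of_forall_fin (ι := ι) (fun k p a => ∀ s : Fin k → Bool,
      |∫ x, P k p s x * d a x ∂μ| ≤ ε k ∧
      |∫ x, P k p s x * q x * d a x ∂μ| ≤ ε k ∧
      |∫ x, P k p s x * d a x ^ 2 ∂μ - ∫ x, P k p s x * q x ∂μ| ≤ ε k ∧
      ∀ j, |∫ x, P k p s x * d (p j) x * d a x ∂μ| ≤ ε k) (by
    intro k p
    have hP : ∀ s, MemLp (P k p s) ⊤ μ := fun s =>
      memLp_top_prod_one_add hm hb Finset.univ p s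
    have small : ∀ φ, MemLp φ 2 μ → ∀ᶠ a in W, |∫ x, φ x * d a x ∂μ| ≤ ε k := fun φ hφ => by
      have := (h0 φ hφ).abs
      rw [abs_zero] at this
      exact (this.eventually (gt_mem_nhds (hε k))).mono fun _ h => le_of_lt h
    refine Eventually.exists (f := W) (eventually_all.2 fun s => ?_)
    refine (small _ ((hP s).mono_exponent le_top)).and
      ((small (fun x => P k p s x * q x) (hq.mul (hP s))).and (Eventually.and ?_
        (eventually_all.2 fun j => small (fun x => P k p s x * d (p j) x)
          (((memLp_top_of_abs_le_one hm hb (p j)).mul (r := ⊤) (hP s)).mono_exponent le_top))))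
    have := ((hdq _ ((hP s).mono_exponent le_top)).sub_const (∫ x, P k p s x * q x ∂μ)).abs
    rw [sub_self, abs_zero] at this
    exact (this.eventually (gt_mem_nhds (hε k))).mono fun _ h => le_of_lt h)
  refine ⟨i, fun s k => ?_⟩
  have e : ∀ x, P k (fun j => i j) (fun j => s j) x = rieszProd d i s k x := fun x =>
    Fin.prod_univ_eq_prod_range (fun j => 1 + boolSign (s j) * d (i j) x) k
  obtain ⟨h1, h2, h3, h4⟩ := hi k fun j => s j
  simp only [e] at h1 h2 h3 h4
  exact ⟨h1, h2, h3, fun j hj => h4 ⟨j, hj⟩⟩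

/-- A bounded family that tends weakly to zero but not in norm contains an `ℓ¹`-sequence for the
supremum norm. -/
theorem exists_seq_l1_of_weak_null (hm : ∀ i, Measurable (d i)) (hb : ∀ i x, |d i x| ≤ 1)
    (W : Filter ι) [W.NeBot]
    (h0 : ∀ φ, MemLp φ 2 μ → Tendsto (fun i => ∫ x, φ x * d i x ∂μ) W (𝓝 0))
    {q : X → ℝ} (hq : MemLp q 2 μ) (hdq : ∀ φ, MemLp φ 2 μ →
      Tendsto (fun i => ∫ x, φ x * d i x ^ 2 ∂μ) W (𝓝 (∫ x, φ x * q x ∂μ)))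
    (hc : 0 < ∫ x, q x ∂μ) :
    ∃ i : ℕ → ι, ∀ (N : ℕ) (a : ℕ → ℝ) (M : ℝ),
      (∀ x, ∑ k ∈ Finset.range N, a k * d (i k) x ≤ M) →
      (∫ x, q x ∂μ) / 2 * ∑ k ∈ Finset.range N, |a k| ≤ M := by
  set c := ∫ x, q x ∂μ with hcdef
  -- `η ≤ 1/8` keeps the mass of the product at most `9/8`; `η ≤ c/8` keeps `c - 2η` at least
  -- `3c/4`. The quotient `2c/3` exceeds the claimed `c/2`.
  obtain ⟨η, hη, hη1, hηc⟩ : ∃ η : ℝ, 0 < η ∧ η ≤ 1 / 8 ∧ η ≤ c / 8 :=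
    ⟨min (1 / 8) (c / 8), by positivity, min_le_left _ _, min_le_right _ _⟩
  obtain ⟨i, hi⟩ := exists_seq_almost_orthogonal (μ := μ) hm hb W h0 hq hdq
    (fun k => η / 2 ^ (k + 1)) fun k => by positivity
  refine ⟨i, fun N a M hM => ?_⟩
  have hPI : ∀ s k, Integrable (rieszProd d i s k) μ := fun s k =>
    (memLp_top_rieszProd hm hb i s k).integrable le_top
  have hPd : ∀ s k j, MemLp (fun x => rieszProd d i s k x * d j x) ⊤ μ := fun s k j =>
    (memLp_top_of_abs_le_one hm hb j).mul (r := ⊤) (memLp_top_rieszProd hm hb i s k)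
  have hPdd : ∀ s k j l, MemLp (fun x => rieszProd d i s k x * d j x * d l x) ⊤ μ :=
    fun s k j l => (memLp_top_of_abs_le_one hm hb l).mul (r := ⊤) (hPd s k j)
  have hPq : ∀ s k, MemLp (fun x => rieszProd d i s k x * q x) 2 μ := fun s k =>
    hq.mul (memLp_top_rieszProd hm hb i s k)
  have hPqd : ∀ s k l, Integrable (fun x => rieszProd d i s k x * q x * d l x) μ := fun s k l =>
    ((memLp_top_of_abs_le_one hm hb l).mul (r := 2) (hPq s k)).integrable (by norm_num)
  have hsucc : ∀ s k x, rieszProd d i s (k + 1) x =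
      rieszProd d i s k x + boolSign (s k) * (rieszProd d i s k x * d (i k) x) := by
    intro s k x
    simp only [rieszProd, Finset.prod_range_succ]; ring
  have step : ∀ (s : ℕ → Bool) (k : ℕ) (g : X → ℝ),
      Integrable (fun x => rieszProd d i s k x * g x) μ →
      Integrable (fun x => rieszProd d i s k x * g x * d (i k) x) μ →
      ∫ x, rieszProd d i s (k + 1) x * g x ∂μ = ∫ x, rieszProd d i s k x * g x ∂μ +
        boolSign (s k) * ∫ x, rieszProd d i s k x * g x * d (i k) x ∂μ := by
    intro s k g h1 h2
    rw [← integral_const_mul, ← integral_add h1 (h2.const_mul _)]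
    refine integral_congr_ae (Eventually.of_forall fun x => ?_)
    simp only [hsucc]; ring
  -- The accumulated error: the sum of `η / 2 ^ (j + 1)` over `j < k`, always below `η`.
  let E : ℕ → ℝ := fun k => η * (1 - 1 / 2 ^ k)
  have hE : ∀ k, E (k + 1) = E k + η / 2 ^ (k + 1) := fun k => by
    simp only [E, pow_succ]; field_simp; ring
  have sgn_bound : ∀ (b : Bool) (t r : ℝ), |t| ≤ r → |boolSign b * t| ≤ r := fun b t r h => by
    rwa [abs_mul, abs_boolSign, one_mul]
  -- A new factor barely changes the integrals against `1`, `q` and earlier `d (i j)`. Against the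
  -- newest function it adds the sign times `∫ P d² ≈ ∫ P q ≈ c`. That case costs the new error
  -- twice, hence `2 * E k`.
  have main : ∀ (s : ℕ → Bool) (k : ℕ), |∫ x, rieszProd d i s k x ∂μ - 1| ≤ E k ∧
      |∫ x, rieszProd d i s k x * q x ∂μ - c| ≤ E k ∧
      ∀ j < k, |∫ x, rieszProd d i s k x * d (i j) x ∂μ - boolSign (s j) * c| ≤ 2 * E k := by
    intro s k
    induction k with
    | zero => simp [rieszProd, E, ← hcdef]
    | succ k ih =>
      obtain ⟨i1, i2, i3⟩ := ih
      obtain ⟨h1, h2, h3, h4⟩ := hi s k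
      have hpos : 0 < η / 2 ^ (k + 1) := by positivity
      refine ⟨?_, ?_, fun j hj => ?_⟩
      · have := step s k (fun _ => 1) (by simpa using hPI s k)
          (by simpa using (hPd s k (i k)).integrable le_top)
        simp only [mul_one] at this
        rw [this, hE, add_sub_right_comm]
        exact (abs_add_le _ _).trans (add_le_add i1 (sgn_bound _ _ _ h1))
      · rw [step s k q ((hPq s k).integrable (by norm_num)) (hPqd s k (i k)), hE,
          add_sub_right_comm]
        exact (abs_add_le _ _).trans (add_le_add i2 (sgn_bound _ _ _ h2))
      · rw [step s k (d (i j)) ((hPd s k _).integrable le_top)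
          ((hPdd s k _ _).integrable le_top), hE]
        rcases Nat.lt_succ_iff_lt_or_eq.1 hj with hj | rfl
        · rw [add_sub_right_comm]
          refine (abs_add_le _ _).trans
            ((add_le_add (i3 j hj) (sgn_bound _ _ _ (h4 j hj))).trans ?_)
          linarith
        · have e : ∫ x, rieszProd d i s j x * d (i j) x * d (i j) x ∂μ =
              ∫ x, rieszProd d i s j x * d (i j) x ^ 2 ∂μ :=
            integral_congr_ae (Eventually.of_forall fun x => by ring)
          rw [e, add_sub_assoc, ← mul_sub]
          have h5 : |∫ x, rieszProd d i s j x * d (i j) x ^ 2 ∂μ - c| ≤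
              η / 2 ^ (j + 1) + E j := by
            refine le_trans ?_ ((abs_add_le _ _).trans (add_le_add h3 i2))
            rw [sub_add_sub_cancel]
          have hE0 : 0 ≤ E j := (abs_nonneg _).trans i1
          refine (abs_add_le _ _).trans ((add_le_add h1 (sgn_bound _ _ _ h5)).trans ?_)
          linarith
  -- With the signs of the coefficients, every term contributes about `c * |a k|` to the integral.
  let s : ℕ → Bool := fun k => decide (0 ≤ a k)
  have hs : ∀ k, a k * boolSign (s k) = |a k| := by
    intro k
    by_cases h : 0 ≤ a k
    · simp [s, boolSign, h, abs_of_nonneg]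
    · simp [s, boolSign, h, abs_of_neg (not_le.1 h)]
  obtain ⟨m1, -, m3⟩ := main s N
  have hEN : E N ≤ η := by
    have : (0 : ℝ) < 1 / 2 ^ N := by positivity
    simp only [E]; nlinarith
  have lower : (c - 2 * η) * ∑ k ∈ Finset.range N, |a k| ≤
      ∫ x, rieszProd d i s N x * ∑ k ∈ Finset.range N, a k * d (i k) x ∂μ := by
    have e : ∫ x, rieszProd d i s N x * ∑ k ∈ Finset.range N, a k * d (i k) x ∂μ =
        ∑ k ∈ Finset.range N, a k * ∫ x, rieszProd d i s N x * d (i k) x ∂μ := by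
      simp_rw [← integral_const_mul]
      rw [← integral_finsetSum _ fun k _ => ((hPd s N (i k)).integrable le_top).const_mul _]
      refine integral_congr_ae (Eventually.of_forall fun x => ?_)
      simp only [Finset.mul_sum]
      exact Finset.sum_congr rfl fun k _ => by ring
    rw [e, Finset.mul_sum]
    refine Finset.sum_le_sum fun k hk => ?_
    have h1 := m3 k (Finset.mem_range.1 hk)
    set t := ∫ x, rieszProd d i s N x * d (i k) x ∂μ
    have h2 : |a k * (t - boolSign (s k) * c)| ≤ |a k| * (2 * η) := by
      rw [abs_mul]
      exact mul_le_mul_of_nonneg_left (h1.trans (by linarith)) (abs_nonneg _)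
    have h3 : a k * (t - boolSign (s k) * c) = a k * t - |a k| * c := by rw [← hs k]; ring
    rw [h3] at h2
    linarith [(abs_le.1 h2).1]
  have upper : ∫ x, rieszProd d i s N x * ∑ k ∈ Finset.range N, a k * d (i k) x ∂μ ≤
      (∫ x, rieszProd d i s N x ∂μ) * M := by
    rw [← integral_mul_const]
    refine integral_mono ?_ ((hPI s N).mul_const M) fun x =>
      mul_le_mul_of_nonneg_left (hM x) (rieszProd_nonneg hb i s N x)
    simp only [Finset.mul_sum]
    refine integrable_finsetSum _ fun k _ => ?_
    refine (((hPd s N (i k)).integrable le_top).const_mul (a k)).congr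
      (Eventually.of_forall fun x => ?_)
    simp only []; ring
  rw [abs_le] at m1
  have hS : 0 ≤ ∑ k ∈ Finset.range N, |a k| := Finset.sum_nonneg fun _ _ => abs_nonneg _
  set S := ∑ k ∈ Finset.range N, |a k|
  set p := ∫ x, rieszProd d i s N x ∂μ
  have h1 : 3 / 4 * c * S ≤ p * M :=
    (mul_le_mul_of_nonneg_right (by linarith) hS).trans (lower.trans upper)
  have hcS : 0 ≤ c * S := mul_nonneg hc.le hS
  have hM0 : 0 ≤ M := by
    by_contra h
    nlinarith [mul_pos_of_neg_of_neg (not_le.1 h) (show -p < 0 by linarith)]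
  nlinarith [mul_le_mul_of_nonneg_right (show p ≤ 9 / 8 by linarith) hM0]

end Riesz

/-! ### From failure of `L²`-convergence to a copy of `ℓ¹` -/

/-- A uniformly bounded sequence of functions that is not `L²`-Cauchy along an ultrafilter has
differences that form an `ℓ¹`-sequence for the supremum norm. -/
theorem exists_seq_l1_of_not_cauchy {X : Type*} [MeasurableSpace X] {μ : Measure X}
    [IsProbabilityMeasure μ] {f : ℕ → X → ℝ} (hm : ∀ n, Measurable (f n)) {C : ℝ}
    (hC : ∀ n x, |f n x| ≤ C) (U : Ultrafilter ℕ)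
    (hU : ¬ Tendsto (fun p : ℕ × ℕ => ∫ x, (f p.1 x - f p.2 x) ^ 2 ∂μ) (U ×ˢ U) (𝓝 0)) :
    ∃ c : ℝ, 0 < c ∧ ∃ i : ℕ → ℕ × ℕ, ∀ (N : ℕ) (a : ℕ → ℝ) (M : ℝ),
      (∀ x, ∑ k ∈ Finset.range N, a k * (f (i k).1 x - f (i k).2 x) ≤ M) →
      c * ∑ k ∈ Finset.range N, |a k| ≤ M := by
  obtain ⟨D, hD, hCD⟩ : ∃ D : ℝ, 0 < D ∧ 2 * C ≤ D :=
    ⟨2 * |C| + 1, by positivity, by linarith [le_abs_self C]⟩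
  let d : ℕ × ℕ → X → ℝ := fun p x => D⁻¹ * (f p.1 x - f p.2 x)
  have hdm : ∀ p, Measurable (d p) := fun p => ((hm _).sub (hm _)).const_mul _
  have hdb : ∀ p x, |d p x| ≤ 1 := fun p x => by
    simp only [d, abs_mul, abs_inv, abs_of_pos hD]
    rw [inv_mul_le_iff₀ hD, mul_one]
    linarith [abs_sub (f p.1 x) (f p.2 x), hC p.1 x, hC p.2 x]
  have hnn : ∀ p : ℕ × ℕ, 0 ≤ ∫ x, (f p.1 x - f p.2 x) ^ 2 ∂μ := fun p =>
    integral_nonneg fun x => sq_nonneg _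
  obtain ⟨e, he, hfreq⟩ : ∃ e : ℝ, 0 < e ∧
      ∃ᶠ p : ℕ × ℕ in U ×ˢ U, e ≤ ∫ x, (f p.1 x - f p.2 x) ^ 2 ∂μ := by
    by_contra! hcon
    refine hU (tendsto_order.2 ⟨fun b hb => Eventually.of_forall fun p => hb.trans_le (hnn p),
      fun b hb => ?_⟩)
    simpa using hcon b hb
  let S : Set (ℕ × ℕ) := {p | e ≤ ∫ x, (f p.1 x - f p.2 x) ^ 2 ∂μ}
  have : NeBot ((U ×ˢ U : Filter (ℕ × ℕ)) ⊓ 𝓟 S) := frequently_mem_iff_neBot.1 hfreq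
  -- `U ×ˢ U` need not be an ultrafilter. Refining it inside `S` gives the squares a weak limit `q`
  -- and keeps their integrals away from zero.
  let W : Ultrafilter (ℕ × ℕ) := Ultrafilter.of ((U ×ˢ U : Filter (ℕ × ℕ)) ⊓ 𝓟 S)
  have hW : (W : Filter (ℕ × ℕ)) ≤ (U ×ˢ U : Filter (ℕ × ℕ)) ⊓ 𝓟 S := Ultrafilter.of_le _
  have hWU : (W : Filter (ℕ × ℕ)) ≤ (U ×ˢ U : Filter (ℕ × ℕ)) := hW.trans inf_le_left
  have hWS : ∀ᶠ p in W, p ∈ S := (hW.trans inf_le_right) (mem_principal_self S)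
  have hfI : ∀ (φ : X → ℝ), MemLp φ 2 μ → ∀ n, Integrable (fun x => φ x * f n x) μ :=
    fun φ hφ n => hφ.integrable_mul (q := 2)
      (MemLp.of_bound (hm n).aestronglyMeasurable C (Eventually.of_forall (hC n)))
  obtain ⟨g, -, hg⟩ := exists_weak_limit_memLp μ U f hm C hC
  obtain ⟨q, hq, hdq⟩ := exists_weak_limit_memLp μ W (fun p x => d p x ^ 2)
    (fun p => (hdm p).pow_const 2) 1 fun p x => by
      rw [abs_pow]; exact pow_le_one₀ (abs_nonneg _) (hdb p x)
  -- Both entries of the pair have the same weak limit `g` along `U`, so it cancels.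
  have h0 : ∀ φ, MemLp φ 2 μ → Tendsto (fun p => ∫ x, φ x * d p x ∂μ) W (𝓝 0) := by
    intro φ hφ
    have h1 := (((hg φ hφ).comp tendsto_fst).sub ((hg φ hφ).comp tendsto_snd)).const_mul D⁻¹
    rw [sub_self, mul_zero] at h1
    refine (h1.mono_left hWU).congr fun p => ?_
    simp only [Function.comp]
    rw [← integral_sub (hfI φ hφ _) (hfI φ hφ _), ← integral_const_mul]
    refine integral_congr_ae (Eventually.of_forall fun x => ?_)
    simp only [d]; ring
  have hqpos : 0 < ∫ x, q x ∂μ := by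
    have h1 := hdq (fun _ => 1) (memLp_const 1)
    simp only [one_mul] at h1
    refine (show 0 < D⁻¹ ^ 2 * e by positivity).trans_le (ge_of_tendsto h1 ?_)
    filter_upwards [hWS] with p hp
    simp only [d, mul_pow]
    rw [integral_const_mul]
    exact mul_le_mul_of_nonneg_left hp (by positivity)
  obtain ⟨i, hi⟩ := exists_seq_l1_of_weak_null hdm hdb W h0 hq hdq hqpos
  refine ⟨D * ((∫ x, q x ∂μ) / 2), by positivity, i, fun N a M hM => ?_⟩
  have := hi N a (D⁻¹ * M) fun x => by
    refine le_trans (le_of_eq ?_) (mul_le_mul_of_nonneg_left (hM x) (inv_nonneg.2 hD.le))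
    rw [Finset.mul_sum]
    exact Finset.sum_congr rfl fun k _ => by simp only [d]; ring
  rwa [le_inv_mul_iff₀ hD, ← mul_assoc] at this

/-- A bounded sequence with a lower `ℓ¹`-estimate generates a copy of `ℓ¹`. -/
theorem containsL1_of_lower_estimate {V : Type*} [NormedAddCommGroup V] [NormedSpace ℝ V]
    [CompleteSpace V] (y : ℕ → V) (B : ℝ) (hB : ∀ k, ‖y k‖ ≤ B) (c : ℝ) (hc : 0 < c)
    (h : ∀ (N : ℕ) (a : ℕ → ℝ), c * ∑ k ∈ Finset.range N, |a k| ≤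
      ‖∑ k ∈ Finset.range N, a k • y k‖) : BanachRep.ContainsL1 V := by
  have hsum : ∀ a : lp (fun _ : ℕ => ℝ) 1, Summable fun k => |a k| := fun a => by
    simpa using (lp.memℓp a).summable (by norm_num)
  have hnorm : ∀ a : lp (fun _ : ℕ => ℝ) 1, ‖a‖ = ∑' k, |a k| := fun a => by
    simpa using lp.norm_eq_tsum_rpow (by norm_num) a
  have hle : ∀ (a : lp (fun _ : ℕ => ℝ) 1) k, ‖a k • y k‖ ≤ |a k| * B := fun a k => by
    rw [norm_smul, Real.norm_eq_abs]
    exact mul_le_mul_of_nonneg_left (hB k) (abs_nonneg _)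
  have hs : ∀ a : lp (fun _ : ℕ => ℝ) 1, Summable fun k => a k • y k := fun a =>
    Summable.of_norm_bounded ((hsum a).mul_right B) (hle a)
  let T : lp (fun _ : ℕ => ℝ) 1 →ₗ[ℝ] V :=
    { toFun := fun a => ∑' k, a k • y k
      map_add' := fun a b => by
        rw [← (hs a).tsum_add (hs b)]
        exact tsum_congr fun k => by rw [lp.coeFn_add, Pi.add_apply, add_smul]
      map_smul' := fun r a => by
        rw [RingHom.id_apply, ← (hs a).tsum_const_smul]
        exact tsum_congr fun k => by rw [lp.coeFn_smul, Pi.smul_apply, smul_assoc] }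
  refine ⟨T.mkContinuous B fun a => ?_, c, hc, fun a => ?_⟩
  · rw [hnorm, mul_comm, ← tsum_mul_right]
    exact tsum_of_norm_bounded ((hsum a).mul_right B).hasSum (hle a)
  · rw [hnorm]
    exact le_of_tendsto_of_tendsto' ((hsum a).hasSum.tendsto_sum_nat.const_mul c)
      (hs a).hasSum.tendsto_sum_nat.norm fun N => h N a

/-- In a Banach space without `ℓ¹`, a bounded sequence is `L²`-Cauchy along every ultrafilter when
evaluated on a bounded measurable family of functionals. -/
theorem tendsto_integral_sq_sub_of_not_containsL1 {V : Type*} [NormedAddCommGroup V]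
    [NormedSpace ℝ V] [CompleteSpace V] (hV : ¬ BanachRep.ContainsL1 V) {X : Type*}
    [MeasurableSpace X] {μ : Measure X} [IsProbabilityMeasure μ] {α : X → WeakDual ℝ V} {C : ℝ}
    (hC : ∀ x, ‖WeakDual.toStrongDual (α x)‖ ≤ C) {y : ℕ → V} {B : ℝ} (hB : ∀ n, ‖y n‖ ≤ B)
    (hm : ∀ n, Measurable fun x => α x (y n)) (U : Ultrafilter ℕ) :
    Tendsto (fun p : ℕ × ℕ => ∫ x, (α x (y p.1) - α x (y p.2)) ^ 2 ∂μ) (U ×ˢ U) (𝓝 0) := by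
  by_contra hcon
  have hne : Nonempty X := nonempty_of_isProbabilityMeasure μ
  have hC0 : 0 ≤ C := (norm_nonneg _).trans (hC hne.some)
  have hα : ∀ x z, |α x z| ≤ C * ‖z‖ := fun x z =>
    ((WeakDual.toStrongDual (α x)).le_opNorm z).trans
      (mul_le_mul_of_nonneg_right (hC x) (norm_nonneg z))
  obtain ⟨c, hc, i, hi⟩ := exists_seq_l1_of_not_cauchy hm (C := C * B)
    (fun n x => (hα x _).trans (mul_le_mul_of_nonneg_left (hB n) hC0)) U hcon
  -- Dividing by `C + 1` rather than `C` covers the case `C = 0`.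
  refine hV (containsL1_of_lower_estimate (fun k => y (i k).1 - y (i k).2) (B + B)
    (fun k => (norm_sub_le _ _).trans (add_le_add (hB _) (hB _))) (c / (C + 1)) (by positivity)
    fun N a => ?_)
  have h1 := hi N a ((C + 1) * ‖∑ k ∈ Finset.range N, a k • (y (i k).1 - y (i k).2)‖) fun x => by
    refine le_trans (le_trans (le_of_eq ?_) ((le_abs_self _).trans (hα x _)))
      (mul_le_mul_of_nonneg_right (by linarith : C ≤ C + 1) (norm_nonneg _))
    simp only [map_sum, map_smul, map_sub, smul_eq_mul]
  rw [div_mul_eq_mul_div, div_le_iff₀ (by positivity), mul_comm ‖_‖]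
  exact h1

/-! ### The algebra of functions with `L²`-Cauchy orbit -/

/-- The squared `L²`-distance of `f ∘ τ n` and `f ∘ τ m`. -/
noncomputable def orbitSqDist {X : Type*} [TopologicalSpace X] [MeasurableSpace X] (μ : Measure X) (τ : ℕ → C(X, X))
    (f : X → ℝ) (p : ℕ × ℕ) : ℝ :=
  ∫ x, (f (τ p.1 x) - f (τ p.2 x)) ^ 2 ∂μ

theorem orbitSqDist_nonneg {X : Type*} [TopologicalSpace X] [MeasurableSpace X] (μ : Measure X)
    (τ : ℕ → C(X, X)) (f : X → ℝ) (p : ℕ × ℕ) : 0 ≤ orbitSqDist μ τ f p :=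
  integral_nonneg fun _ => sq_nonneg _

section Orbit

variable {X : Type*} [TopologicalSpace X] [CompactSpace X] [MeasurableSpace X] [BorelSpace X]

theorem integrable_of_continuous_compact (μ : Measure X) [IsFiniteMeasure μ] {f : X → ℝ}
    (hf : Continuous f) : Integrable f μ :=
  hf.integrable_of_hasCompactSupport (HasCompactSupport.of_compactSpace f)

variable (μ : Measure X) [IsProbabilityMeasure μ] (τ : ℕ → C(X, X))

theorem orbitSqDist_add_le (f g : C(X, ℝ)) (p : ℕ × ℕ) :
    orbitSqDist μ τ (f + g) p ≤ 2 * orbitSqDist μ τ f p + 2 * orbitSqDist μ τ g p := by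
  unfold orbitSqDist
  rw [← integral_const_mul, ← integral_const_mul, ← integral_add
    (integrable_of_continuous_compact μ (by fun_prop))
    (integrable_of_continuous_compact μ (by fun_prop))]
  refine integral_mono (integrable_of_continuous_compact μ (by fun_prop))
    (integrable_of_continuous_compact μ (by fun_prop)) fun x => ?_
  simp only [Pi.add_apply]
  nlinarith [sq_nonneg ((f (τ p.1 x) - f (τ p.2 x)) - (g (τ p.1 x) - g (τ p.2 x)))]

/-- From `a a' - b b' = a (a' - b') + b' (a - b)` and the uniform bounds on `a` and `b'`. -/
theorem orbitSqDist_mul_le (f g : C(X, ℝ)) (p : ℕ × ℕ) :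
    orbitSqDist μ τ (f * g) p ≤
      2 * ‖f‖ ^ 2 * orbitSqDist μ τ g p + 2 * ‖g‖ ^ 2 * orbitSqDist μ τ f p := by
  unfold orbitSqDist
  rw [← integral_const_mul, ← integral_const_mul, ← integral_add
    (integrable_of_continuous_compact μ (by fun_prop))
    (integrable_of_continuous_compact μ (by fun_prop))]
  refine integral_mono (integrable_of_continuous_compact μ (by fun_prop))
    (integrable_of_continuous_compact μ (by fun_prop)) fun x => ?_
  simp only [Pi.mul_apply]
  have hf : f (τ p.1 x) ^ 2 ≤ ‖f‖ ^ 2 := sq_le_sq' (abs_le.1 (f.norm_coe_le_norm _)).1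
    (abs_le.1 (f.norm_coe_le_norm _)).2
  have hg : g (τ p.2 x) ^ 2 ≤ ‖g‖ ^ 2 := sq_le_sq' (abs_le.1 (g.norm_coe_le_norm _)).1
    (abs_le.1 (g.norm_coe_le_norm _)).2
  set a := f (τ p.1 x)
  set b := f (τ p.2 x)
  set a' := g (τ p.1 x)
  set b' := g (τ p.2 x)
  have h1 : (a * a' - b * b') ^ 2 ≤ 2 * a ^ 2 * (a' - b') ^ 2 + 2 * b' ^ 2 * (a - b) ^ 2 := by
    nlinarith [sq_nonneg (a * (a' - b') - b' * (a - b))]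
  nlinarith [mul_le_mul_of_nonneg_right hf (sq_nonneg (a' - b')),
    mul_le_mul_of_nonneg_right hg (sq_nonneg (a - b))]

theorem orbitSqDist_le_norm_sq (f : C(X, ℝ)) (p : ℕ × ℕ) :
    orbitSqDist μ τ f p ≤ 4 * ‖f‖ ^ 2 := by
  have : orbitSqDist μ τ f p ≤ ∫ _, 4 * ‖f‖ ^ 2 ∂μ := by
    refine integral_mono (integrable_of_continuous_compact μ (by fun_prop))
      (integrable_const _) fun x => ?_
    have h1 := abs_le.1 (f.norm_coe_le_norm (τ p.1 x))
    have h2 := abs_le.1 (f.norm_coe_le_norm (τ p.2 x))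
    simp only []
    nlinarith [norm_nonneg f]
  simpa using this

/-- The functions whose orbit under `τ` is `L²`-Cauchy along `U`. -/
noncomputable def orbitCauchySubalgebra (U : Filter ℕ) : Subalgebra ℝ C(X, ℝ) where
  carrier := {f | Tendsto (orbitSqDist μ τ f) (U ×ˢ U) (𝓝 0)}
  mul_mem' {f g} hf hg := by
    have h := (Tendsto.const_mul (2 * ‖f‖ ^ 2) hg).add (Tendsto.const_mul (2 * ‖g‖ ^ 2) hf)
    simp only [mul_zero, add_zero] at h
    exact squeeze_zero (orbitSqDist_nonneg μ τ _) (orbitSqDist_mul_le μ τ f g) h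
  add_mem' {f g} hf hg := by
    have h := (Tendsto.const_mul 2 hf).add (Tendsto.const_mul 2 hg)
    simp only [mul_zero, add_zero] at h
    exact squeeze_zero (orbitSqDist_nonneg μ τ _) (orbitSqDist_add_le μ τ f g) h
  algebraMap_mem' r := by
    have : orbitSqDist μ τ (algebraMap ℝ C(X, ℝ) r) = fun _ => 0 := by
      funext p; simp [orbitSqDist]
    simp only [Set.mem_ofPred_eq, this]
    exact tendsto_const_nhds

/-- If the functions with `L²`-Cauchy orbit separate points, then every continuous function has
`L²`-Cauchy orbit. -/
theorem tendsto_orbitSqDist_of_separatesPoints (U : Filter ℕ)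
    (h : (orbitCauchySubalgebra μ τ U).SeparatesPoints) (f : C(X, ℝ)) :
    Tendsto (orbitSqDist μ τ f) (U ×ˢ U) (𝓝 0) := by
  have hf : f ∈ closure (orbitCauchySubalgebra μ τ U : Set C(X, ℝ)) := by
    rw [← Subalgebra.topologicalClosure_coe,
      ContinuousMap.subalgebra_topologicalClosure_eq_top_of_separatesPoints _ h]
    trivial
  refine tendsto_order.2 ⟨fun b hb => Eventually.of_forall fun p =>
    hb.trans_le (orbitSqDist_nonneg μ τ f p), fun b hb => ?_⟩
  -- The minimum with `1` gives `‖f - g‖ ^ 2 < b / 16`; the total is then below `2 * 4 * (b / 16) +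
  -- 2 * (b / 4) = b`.
  obtain ⟨g, hg, hfg⟩ := Metric.mem_closure_iff.1 hf (min 1 (b / 16)) (by positivity)
  rw [dist_eq_norm] at hfg
  have h1 : ‖f - g‖ ^ 2 < b / 16 := by
    have a1 := hfg.trans_le (min_le_left _ _)
    have a2 := hfg.trans_le (min_le_right _ _)
    nlinarith [norm_nonneg (f - g)]
  have h2 : ∀ᶠ p in (U ×ˢ U : Filter (ℕ × ℕ)), orbitSqDist μ τ g p < b / 4 :=
    (show Tendsto (orbitSqDist μ τ g) (U ×ˢ U) (𝓝 0) from hg).eventually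
      (gt_mem_nhds (by positivity))
  filter_upwards [h2] with p hp
  have h3 := orbitSqDist_add_le μ τ (f - g) g p
  have h4 := orbitSqDist_le_norm_sq μ τ (f - g) p
  have e : ((f - g : C(X, ℝ)) : X → ℝ) + g = f := by funext x; simp
  rw [e] at h3
  linarith

end Orbit

/-! ### Orthogonality of characters -/

section Character

variable {K : Type*} [Group K] [TopologicalSpace K] [IsTopologicalGroup K]
  [MeasurableSpace K] [BorelSpace K]

/-- A nontrivial character of a compact group has integral zero. -/
theorem integral_character_eq_zero (μ : Measure K) [μ.IsMulLeftInvariant] (ξ : K →* Circle)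
    (h : ξ ≠ 1) : ∫ x, (ξ x : ℂ) ∂μ = 0 := by
  obtain ⟨a, ha⟩ : ∃ a, ξ a ≠ 1 := by
    by_contra! hcon
    exact h (MonoidHom.ext hcon)
  -- Translating by `a` multiplies the integral by `ξ a ≠ 1`.
  have h1 := integral_mul_left_eq_self (μ := μ) (fun x => (ξ x : ℂ)) a
  simp only [map_mul, Circle.coe_mul] at h1
  rw [integral_const_mul] at h1
  by_contra h0
  exact ha (Circle.ext (mul_right_cancel₀ h0 (h1.trans (one_mul _).symm)))

/-- Pointwise the integrands add up to `2 - 2 Re (ξ ψ̄)`, and `ξ ψ̄` is a nontrivial character. -/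
theorem integral_sq_sub_character [CompactSpace K] (μ : Measure K) [IsProbabilityMeasure μ] [μ.IsMulLeftInvariant]
    (ξ ψ : K →* Circle) (hξ : Continuous ξ) (hψ : Continuous ψ) (h : ξ ≠ ψ) :
    ∫ x, ((ξ x : ℂ).re - (ψ x : ℂ).re) ^ 2 ∂μ + ∫ x, ((ξ x : ℂ).im - (ψ x : ℂ).im) ^ 2 ∂μ = 2 := by
  have hc : Continuous fun x => (ξ x : ℂ) * (starRingEnd ℂ) (ψ x) := by fun_prop
  have h0 : ∫ x, (ξ x : ℂ) * (starRingEnd ℂ) (ψ x) ∂μ = 0 := by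
    rw [← integral_character_eq_zero μ (ξ / ψ) (div_ne_one.2 h)]
    refine integral_congr_ae (Eventually.of_forall fun x => ?_)
    change _ = ((ξ x / ψ x : Circle) : ℂ)
    rw [div_eq_mul_inv, Circle.coe_mul, Circle.coe_inv_eq_conj]
  have hre : ∫ x, ((ξ x : ℂ) * (starRingEnd ℂ) (ψ x)).re ∂μ = 0 := by
    have h1 := integral_re (𝕜 := ℂ)
      (hc.integrable_of_hasCompactSupport (μ := μ) (HasCompactSupport.of_compactSpace _))
    rw [h0] at h1
    exact h1
  rw [← integral_add (integrable_of_continuous_compact μ (by fun_prop))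
    (integrable_of_continuous_compact μ (by fun_prop))]
  have e : ∀ x, ((ξ x : ℂ).re - (ψ x : ℂ).re) ^ 2 + ((ξ x : ℂ).im - (ψ x : ℂ).im) ^ 2 =
      2 - 2 * ((ξ x : ℂ) * (starRingEnd ℂ) (ψ x)).re := by
    intro x
    have h1 : Complex.normSq (ξ x : ℂ) = 1 := Circle.normSq_coe _
    have h2 : Complex.normSq (ψ x : ℂ) = 1 := Circle.normSq_coe _
    simp only [Complex.normSq_apply] at h1 h2
    simp only [Complex.mul_re, Complex.conj_re, Complex.conj_im]
    linear_combination h1 + h2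
  simp_rw [e]
  rw [integral_sub (integrable_const _) (integrable_of_continuous_compact μ (by fun_prop)),
    integral_const_mul, hre]
  simp

/-- Pairwise distinct characters along the orbit prevent the orbit from being `L²`-Cauchy along a
nonprincipal ultrafilter. -/
theorem not_forall_tendsto_orbitSqDist [CompactSpace K] (μ : Measure K) [IsProbabilityMeasure μ]
    [μ.IsMulLeftInvariant] (τ : ℕ → C(K, K)) (χ : C(K, Circle)) (ξ : ℕ → K →* Circle)
    (hξ : ∀ n x, ξ n x = χ (τ n x)) (hinj : Function.Injective ξ) :
    ¬ ∀ f : C(K, ℝ), Tendsto (orbitSqDist μ τ f) (hyperfilter ℕ ×ˢ hyperfilter ℕ) (𝓝 0) := by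
  intro h
  have h1 := (h ⟨fun x => (χ x : ℂ).re, by fun_prop⟩).add (h ⟨fun x => (χ x : ℂ).im, by fun_prop⟩)
  rw [add_zero] at h1
  have h2 := h1.eventually (gt_mem_nhds (show (0 : ℝ) < 1 by norm_num))
  obtain ⟨P, hP, Q, hQ, hPQ⟩ := eventually_prod_iff.1 h2
  -- A set in a nonprincipal ultrafilter is infinite, which yields two different indices.
  have hfreq : ∃ᶠ n in atTop, P n ∧ Q n :=
    ((hP.and hQ).frequently).filter_mono (by
      rw [← Nat.cofinite_eq_atTop]; exact hyperfilter_le_cofinite)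
  obtain ⟨n, hn⟩ := hfreq.exists
  obtain ⟨m, hnm, hm⟩ := (frequently_atTop.1 hfreq) (n + 1)
  have h3 := hPQ hn.1 hm.2
  have hcont : ∀ n, Continuous (ξ n) := fun n => by
    have : (ξ n : K → Circle) = fun x => χ (τ n x) := funext (hξ n)
    rw [this]; fun_prop
  have h4 := integral_sq_sub_character μ (ξ n) (ξ m) (hcont n) (hcont m)
    (hinj.ne (by omega))
  simp only [hξ] at h4
  simp only [orbitSqDist, ContinuousMap.coe_mk] at h3
  rw [h4] at h3
  norm_num at h3

end Character

/-! ### The torus automorphism inside the conjugation action -/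

namespace BanachRep

/-- An automorphism of the torus of infinite order moves one of the two coordinate characters along
an infinite orbit. -/
theorem exists_character_injective_orbit (σ : MulAut Torus) (hσ : ¬ IsOfFinOrder σ) :
    ∃ χ : Torus →* Circle, Continuous χ ∧
      Function.Injective fun n : ℕ => χ.comp (σ ^ n : MulAut Torus).toMonoidHom := by
  -- A repetition in the orbit makes `χ` invariant under a positive power of `σ`, since `σ` is
  -- invertible.
  have key : ∀ χ : Torus →* Circle,
      ¬ Function.Injective (fun n : ℕ => χ.comp (σ ^ n : MulAut Torus).toMonoidHom) →
      ∃ k : ℕ, 0 < k ∧ ∀ l : ℕ, ∀ t, χ ((σ ^ (k * l)) t) = χ t := by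
    intro χ hχ
    have hlt : ∃ n m : ℕ, n < m ∧ ∀ t, χ ((σ ^ n) t) = χ ((σ ^ m) t) := by
      simp only [Function.Injective, not_forall] at hχ
      obtain ⟨n, m, h, hne⟩ := hχ
      have h' : ∀ t, χ ((σ ^ n) t) = χ ((σ ^ m) t) := fun t => DFunLike.congr_fun h t
      rcases lt_or_gt_of_ne hne with hlt | hlt
      · exact ⟨n, m, hlt, h'⟩
      · exact ⟨m, n, hlt, fun t => (h' t).symm⟩
    obtain ⟨n, m, hlt, h⟩ := hlt
    refine ⟨m - n, Nat.sub_pos_of_lt hlt, fun l => ?_⟩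
    have hk : ∀ t, χ ((σ ^ (m - n)) t) = χ t := fun t => by
      have := h ((σ ^ n)⁻¹ t)
      rw [← MulAut.mul_apply, ← MulAut.mul_apply, mul_inv_cancel,
        ← pow_sub _ hlt.le] at this
      exact this.symm
    induction l with
    | zero => simp
    | succ l ih =>
      intro t
      rw [mul_add, mul_one, pow_add, MulAut.mul_apply, ih, hk]
  by_contra! hcon
  obtain ⟨k, hk, h1⟩ := key (MonoidHom.fst Circle Circle) (hcon _ continuous_fst)
  obtain ⟨l, hl, h2⟩ := key (MonoidHom.snd Circle Circle) (hcon _ continuous_snd)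
  -- If both coordinates were periodic, `σ ^ (k * l)` would fix both of them and be the identity.
  refine hσ (isOfFinOrder_iff_pow_eq_one.2 ⟨k * l, Nat.mul_pos hk hl, MulEquiv.ext fun t => ?_⟩)
  have e2 := h2 k t
  rw [mul_comm] at e2
  exact Prod.ext (h1 l t) e2

/-- The embedding of the torus into the space of the conjugation action. -/
noncomputable def torusInl (σ : Torus ≃ₜ* Torus) (t : Torus) : ConjSpace (TorusSemidirect σ) :=
  (SemidirectProduct.inl t : TorusSemidirect σ)

theorem continuous_torusInl (σ : Torus ≃ₜ* Torus) : Continuous (torusInl σ) :=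
  continuous_induced_rng.2 (continuous_id.prodMk continuous_const)

theorem torusInl_injective (σ : Torus ≃ₜ* Torus) : Function.Injective (torusInl σ) :=
  SemidirectProduct.inl_injective

/-- Conjugation by the integer `n` acts on the torus as `σ ^ n`. -/
theorem inr_smul_torusInl (σ : Torus ≃ₜ* Torus) (n : ℕ) (t : Torus) :
    (SemidirectProduct.inr (Multiplicative.ofAdd (n : ℤ)) : TorusSemidirect σ) • torusInl σ t =
      torusInl σ ((σ.toMulEquiv ^ n : MulAut Torus) t) := by
  have := SemidirectProduct.inl_aut (φ := zpowersHom (MulAut Torus) σ.toMulEquiv)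
    (Multiplicative.ofAdd (n : ℤ)) t
  rw [zpowersHom_apply, toAdd_ofAdd, zpow_natCast] at this
  rw [map_inv] at this
  exact this.symm

theorem continuous_pow (σ : Torus ≃ₜ* Torus) (n : ℕ) :
    Continuous (σ.toMulEquiv ^ n : MulAut Torus) := by
  have := continuous_zpow σ n
  rwa [zpow_natCast] at this

end BanachRep

/-! ### The contradiction -/

open BanachRep in
theorem corollary3p16 (σ : BanachRep.Torus ≃ₜ* BanachRep.Torus)
    (hσ : ¬ IsOfFinOrder (σ.toMulEquiv : MulAut BanachRep.Torus)) :
    ¬ BanachRep.RosenthalRepresentable.{w} (BanachRep.TorusSemidirect σ)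
        (BanachRep.ConjSpace (BanachRep.TorusSemidirect σ)) := by
  rintro ⟨V, _, _, _, hV, ⟨R⟩⟩
  let _ : MeasurableSpace Torus := borel Torus
  have : BorelSpace Torus := ⟨rfl⟩
  let μ : Measure Torus := Measure.haarMeasure ⊤
  have : IsProbabilityMeasure μ := ⟨Measure.haarMeasure_self (K₀ := ⊤)⟩
  let τ : ℕ → C(Torus, Torus) := fun n => ⟨(σ.toMulEquiv ^ n : MulAut Torus), continuous_pow σ n⟩
  obtain ⟨χ, hχ, hinj⟩ := exists_character_injective_orbit σ.toMulEquiv hσ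
  refine not_forall_tendsto_orbitSqDist μ τ ⟨χ, hχ⟩ _ (fun n x => rfl) hinj
    (tendsto_orbitSqDist_of_separatesPoints μ τ _ ?_)
  let β : Torus → WeakDual ℝ V := fun t => R.α (torusInl σ t)
  have hβ : Continuous β := R.isEmbedding_α.continuous.comp (continuous_torusInl σ)
  let f : V → C(Torus, ℝ) := fun v => ⟨fun t => β t v, (WeakDual.eval_continuous v).comp hβ⟩
  obtain ⟨C, hC⟩ := R.bounded_α
  have hf : ∀ v, f v ∈ orbitCauchySubalgebra μ τ (hyperfilter ℕ) := by
    intro v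
    let g : ℕ → TorusSemidirect σ := fun n =>
      SemidirectProduct.inr (Multiplicative.ofAdd (n : ℤ))
    -- Conjugation by `n` is `σ ^ n` on the torus, and the dual action moves it onto `v` as an
    -- inverse isometry.
    have hg : ∀ n t, f v (τ n t) = β t ((R.h (g n))⁻¹ v) := fun n t => by
      have h1 := R.equivariant (g n) (torusInl σ t)
      rw [inr_smul_torusInl] at h1
      exact DFunLike.congr_fun h1 v
    have h2 := tendsto_integral_sq_sub_of_not_containsL1 hV (μ := μ) (α := β)
      (fun t => hC _) (y := fun n => (R.h (g n))⁻¹ v) (B := ‖v‖)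
      (fun n => ((R.h (g n))⁻¹.norm_map v).le)
      (fun n => ((WeakDual.eval_continuous _).comp hβ).measurable) (hyperfilter ℕ)
    refine h2.congr fun p => ?_
    simp only [orbitSqDist, hg]
  intro s t hst
  have hne : β s ≠ β t := fun h => hst (torusInl_injective σ (R.isEmbedding_α.injective h))
  obtain ⟨v, hv⟩ := DFunLike.ne_iff.1 hne
  exact ⟨f v, ⟨f v, hf v, rfl⟩, hv⟩
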